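/- Let $\mu$ be a Borel probability measure on $\mathbb R^n$ with a log-concave density $\rho$ (that is, $\rho\ge 0$ and $-\log\rho:\mathbb R^n\to(-\infty,\infty]$ is convex) and with barycenter at the origin. Let $$\Lambda_\mu(\xi)=\log\int_{\mathbb R^n} e^{\langle \xi,y\rangle}\,d\mu(y)\in(-\infty,\infty],\qquad \Lambda_p(\mu)=\{\Lambda_\mu\le p\}\cap-\{\Lambda_\mu\le p\}\quad(p\ge 0),$$ and, for $p\ge 1$, let $Z_p(\mu)\subset\mathbb R^n$ be the convex body with supporting functional $h_{Z_p(\mu)}(\theta)=\left(\int_{\mathbb R^n}|\langle y,\theta\rangle|^p\,d\mu(y)\right)^{1/p}$, i.e. $Z_p(\mu)=\{z:\langle z,\theta\rangle\le h_{Z_p(\mu)}(\theta)\ \text{for all }\theta\in\mathbb R^n\}$. For $x$ with $\Lambda_\mu(x)<\infty$, let the tilt $\mu_x$ be the probability measure obtained from the one with density $\rho(y)e^{\langle x,y\rangle}/\int\rho(u)e^{\langle x,u\rangle}\,du$ by the translation that moves its barycenter to the origin. There are universal constants $c,C,c',C'>0$ (independent of $n$, $\mu$, $p$ and $x$) such that: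 1. for every $p\ge 0$ and every $x\in\frac12\Lambda_p(\mu)$, $\quad c\,\Lambda_p(\mu_x)\subseteq\Lambda_p(\mu)\subseteq C\,\Lambda_p(\mu_x)$; 2. for every $p\ge 1$ and every $x\in\frac12\Lambda_p(\mu)$, $\quad c'\,Z_p(\mu_x)\subseteq Z_p(\mu)\subseteq C'\,Z_p(\mu_x)$. -/

import Mathlib

open scoped Pointwise

noncomputable section

namespace LogConcaveTilt

open MeasureTheory

/-- A nonnegative function `ρ` is log-concave, i.e. `-log ρ : ℝⁿ → (-∞, ∞]` is convex. -/
def IsLogConcaveFun {n : ℕ} (ρ : EuclideanSpace ℝ (Fin n) → ℝ) : Prop :=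
  (∀ x, 0 ≤ ρ x) ∧
    ∀ x y : EuclideanSpace ℝ (Fin n), ∀ a b : ℝ, 0 < a → 0 < b → a + b = 1 →
      ρ x ^ a * ρ y ^ b ≤ ρ (a • x + b • y)

/-- A measure on `ℝⁿ` is log-concave if it has a log-concave density
with respect to Lebesgue measure. -/
def IsLogConcave {n : ℕ} (μ : Measure (EuclideanSpace ℝ (Fin n))) : Prop :=
  ∃ ρ : EuclideanSpace ℝ (Fin n) → ℝ, Measurable ρ ∧ IsLogConcaveFun ρ ∧
    μ = volume.withDensity (fun x => ENNReal.ofReal (ρ x))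

/-- The barycenter of a probability measure on `ℝⁿ` exists and is the origin. -/
def IsCentered {n : ℕ} (μ : Measure (EuclideanSpace ℝ (Fin n))) : Prop :=
  Integrable (fun x => x) μ ∧ ∫ x, x ∂μ = 0

/-- The logarithmic Laplace transform `Λ_μ(ξ) = log ∫ exp ⟨ξ, x⟩ dμ(x)`,
which may take the value `∞`. -/
def logLaplace {n : ℕ} (μ : Measure (EuclideanSpace ℝ (Fin n)))
    (ξ : EuclideanSpace ℝ (Fin n)) : EReal :=
  ENNReal.log (∫⁻ x, ENNReal.ofReal (Real.exp (inner ℝ ξ x)) ∂μ)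

/-- The body `Λ_p(μ) = {Λ_μ ≤ p} ∩ -{Λ_μ ≤ p}`. -/
def lambdaBody {n : ℕ} (p : ℝ) (μ : Measure (EuclideanSpace ℝ (Fin n))) :
    Set (EuclideanSpace ℝ (Fin n)) :=
  {ξ | logLaplace μ ξ ≤ (p : EReal)} ∩ -{ξ | logLaplace μ ξ ≤ (p : EReal)}

/-- The function `h_{Z_p(μ)}(θ) = (∫ |⟨x, θ⟩|^p dμ(x))^{1/p}`. -/
def centroidSupport {n : ℕ} (p : ℝ) (μ : Measure (EuclideanSpace ℝ (Fin n)))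
    (θ : EuclideanSpace ℝ (Fin n)) : ℝ :=
  (∫ x, |inner ℝ x θ| ^ p ∂μ) ^ (1 / p)

/-- The `L_p`-centroid body `Z_p(μ)`: the closed convex set whose supporting functional is
`h_{Z_p(μ)}`. -/
def centroidBody {n : ℕ} (p : ℝ) (μ : Measure (EuclideanSpace ℝ (Fin n))) :
    Set (EuclideanSpace ℝ (Fin n)) :=
  {y | ∀ θ : EuclideanSpace ℝ (Fin n), inner ℝ y θ ≤ centroidSupport p μ θ}

/-- The measure with density proportional to `exp ⟨ξ, x⟩` with respect to `μ`, before
recentering. If `μ` has density `ρ`, its density is `ρ(x) exp ⟨ξ, x⟩ / Z_ξ`. -/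
def expTilt {n : ℕ} (μ : Measure (EuclideanSpace ℝ (Fin n)))
    (ξ : EuclideanSpace ℝ (Fin n)) : Measure (EuclideanSpace ℝ (Fin n)) :=
  μ.tilted (fun x => inner ℝ ξ x)

/-- The barycenter `b_ξ` of the exponentially tilted measure. -/
def tiltBarycenter {n : ℕ} (μ : Measure (EuclideanSpace ℝ (Fin n)))
    (ξ : EuclideanSpace ℝ (Fin n)) : EuclideanSpace ℝ (Fin n) :=
  ∫ x, x ∂(expTilt μ ξ)

/-- The tilt `μ_ξ`: the exponentially tilted measure, translated so that its barycenter
is the origin. -/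
def tilt {n : ℕ} (μ : Measure (EuclideanSpace ℝ (Fin n)))
    (ξ : EuclideanSpace ℝ (Fin n)) : Measure (EuclideanSpace ℝ (Fin n)) :=
  (expTilt μ ξ).map (fun x => x - tiltBarycenter μ ξ)

/-- `c K ⊆ T ⊆ C K`. -/
def IsoWith {n : ℕ} (c C : ℝ) (K T : Set (EuclideanSpace ℝ (Fin n))) : Prop :=
  c • K ⊆ T ∧ T ⊆ C • K

end LogConcaveTilt

end

/-!
The Prékopa–Leindler inequality yields Borell's lemma: along a seminorm `q`, the tails of a
log-concave probability measure decay exponentially at the scale of the `p`-th moment of `q`. Hence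
`∫ exp ⟪θ, y⟫ dμ ≤ exp p` as soon as `h_{Z_p(μ)}(θ)` is at most a small multiple of `p`. Conversely
`|s| ^ p ≤ p ^ p * exp |s|` bounds the moment by the exponential integral, so `Z_p(μ)` is, up to
universal constants, `p` times the polar body of `Λ_p(μ)`, and the second claim follows from the
first.

For the first claim, let `b` be the barycenter of the exponentially tilted measure before it is
recentered. Then `Λ_{μ_x}(z) = Λ_μ(x + z) - Λ_μ(x) - ⟪z, b⟫`. By Jensen's inequality both transforms
are nonnegative, and adding the identities at `z` and `-z` cancels the linear term: a bound on one
transform at two opposite points bounds the other. Convexity of `Λ_μ` does the rest.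
-/

namespace LogConcaveTilt

open MeasureTheory Set
open scoped ENNReal NNReal RealInnerProductSpace

theorem volume_add_volume_le_volume_add_of_isCompact {A B : Set ℝ} (hA : IsCompact A)
    (hB : IsCompact B) (hA₀ : A.Nonempty) (hB₀ : B.Nonempty) :
    volume A + volume B ≤ volume (A + B) := by
  obtain ⟨α, hαA, hα⟩ := hA.exists_isGreatest hA₀
  obtain ⟨β, hβB, hβ⟩ := hB.exists_isLeast hB₀
  -- The translates `β +ᵥ A` and `α +ᵥ B` lie on opposite sides of their common point `α + β`.
  have hdisj : AEDisjoint volume (β +ᵥ A) (α +ᵥ B) := by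
    refine measure_mono_null (t := {α + β}) ?_ (by simp)
    rintro _ ⟨⟨x, hx, rfl⟩, ⟨y, hy, hxy⟩⟩
    have := hα hx
    have := hβ hy
    simp only [vadd_eq_add, mem_singleton_iff] at *
    linarith
  calc volume A + volume B = volume ((β +ᵥ A) ∪ (α +ᵥ B)) := by
        rw [measure_union₀ (hB.vadd α).measurableSet.nullMeasurableSet hdisj, measure_vadd,
          measure_vadd]
    _ ≤ volume (A + B) := by
        refine measure_mono (union_subset ?_ (vadd_set_subset_add hαA))
        rw [add_comm A]
        exact vadd_set_subset_add hβB

theorem volume_add_volume_le_volume_add {A B : Set ℝ} (hA : MeasurableSet A)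
    (hB : MeasurableSet B) (hA₀ : A.Nonempty) (hB₀ : B.Nonempty) :
    volume A + volume B ≤ volume (A + B) := by
  obtain ⟨x, hx⟩ := hA₀
  obtain ⟨y, hy⟩ := hB₀
  simp only [hA.measure_eq_iSup_isCompact volume, hB.measure_eq_iSup_isCompact volume,
    iSup_and']
  refine ENNReal.biSup_add_biSup_le' ⟨∅, empty_subset _, isCompact_empty⟩
    ⟨∅, empty_subset _, isCompact_empty⟩ fun K hK L hL => ?_
  calc volume K + volume L ≤ volume (insert x K) + volume (insert y L) := by
        gcongr <;> exact subset_insert _ _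
    _ ≤ volume (insert x K + insert y L) :=
        volume_add_volume_le_volume_add_of_isCompact (hK.2.insert x) (hL.2.insert y)
          (insert_nonempty x K) (insert_nonempty y L)
    _ ≤ volume (A + B) :=
        measure_mono (add_subset_add (insert_subset hx hK.1) (insert_subset hy hL.1))

theorem ofReal_mul_volume_add_le_volume {A B C : Set ℝ} {a b : ℝ} (ha : 0 < a) (hb : 0 < b)
    (hA : MeasurableSet A) (hB : MeasurableSet B) (hA₀ : A.Nonempty) (hB₀ : B.Nonempty)
    (hC : ∀ x ∈ A, ∀ y ∈ B, a • x + b • y ∈ C) :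
    ENNReal.ofReal a * volume A + ENNReal.ofReal b * volume B ≤ volume C := by
  have h := volume_add_volume_le_volume_add (hA.const_smul₀ a) (hB.const_smul₀ b)
    (hA₀.smul_set (a := a)) (hB₀.smul_set (a := b))
  simp only [Measure.addHaar_smul, Module.finrank_self, pow_one, abs_of_pos ha,
    abs_of_pos hb] at h
  refine h.trans (measure_mono ?_)
  rintro _ ⟨_, ⟨x, hx, rfl⟩, _, ⟨y, hy, rfl⟩, rfl⟩
  exact hC x hx y hy

section LayerCake

variable {α : Type*} [MeasurableSpace α] (μ : Measure α) {f : α → ℝ≥0∞}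

theorem lintegral_eq_lintegral_meas_ofReal_lt (hf : Measurable f) (hf_top : ∀ x, f x ≠ ∞) :
    ∫⁻ x, f x ∂μ = ∫⁻ t in Ioi (0 : ℝ), μ {x | ENNReal.ofReal t < f x} := by
  have h := lintegral_eq_lintegral_meas_lt μ (ae_of_all _ fun x => (f x).toReal_nonneg)
    hf.ennreal_toReal.aemeasurable
  simp only [ENNReal.ofReal_toReal (hf_top _)] at h
  rw [h]
  refine setLIntegral_congr_fun measurableSet_Ioi fun t ht => ?_
  simp only [ENNReal.ofReal_lt_iff_lt_toReal (le_of_lt ht) (hf_top _)]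

theorem antitone_measure_ofReal_lt (f : α → ℝ≥0∞) :
    Antitone fun t : ℝ => μ {x | ENNReal.ofReal t < f x} := fun _ _ hst =>
  measure_mono fun _ hx => (ENNReal.ofReal_le_ofReal hst).trans_lt hx

theorem lintegral_eq_iSup_lintegral_min_natCast (hf : Measurable f) :
    ∫⁻ x, f x ∂μ = ⨆ N : ℕ, ∫⁻ x, min (f x) N ∂μ := by
  rw [← lintegral_iSup (fun N => hf.min measurable_const)
    fun M N hMN x => min_le_min le_rfl (Nat.cast_le.2 hMN)]
  simp only [← inf_iSup_eq, ENNReal.iSup_natCast, inf_top_eq]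

end LayerCake

theorem ennreal_geom_mean_le_arith_mean2_weighted {a b : ℝ} (ha : 0 < a) (hb : 0 < b)
    (hab : a + b = 1) (u v : ℝ≥0∞) :
    u ^ a * v ^ b ≤ ENNReal.ofReal a * u + ENNReal.ofReal b * v := by
  have h := ENNReal.young_inequality (u ^ a) (v ^ b) (Real.HolderConjugate.inv_inv ha hb hab)
  simpa only [ENNReal.rpow_rpow_inv ha.ne', ENNReal.rpow_rpow_inv hb.ne',
    ENNReal.ofReal_inv_of_pos ha, ENNReal.ofReal_inv_of_pos hb, div_eq_mul_inv, inv_inv,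
    mul_comm u, mul_comm v] using h

section RealLine

variable {f g h : ℝ → ℝ≥0∞} {a b : ℝ}

/- With both suprema equal to `1` the superlevel sets of `f` and `g` at any height `t < 1` are
nonempty, so that the Brunn–Minkowski inequality applies to them. -/
theorem ofReal_mul_lintegral_add_le_lintegral (ha : 0 < a) (hb : 0 < b) (hab : a + b = 1)
    (hf : Measurable f) (hg : Measurable g) (hh : Measurable h)
    (hf₁ : ⨆ x, f x = 1) (hg₁ : ⨆ x, g x = 1)
    (H : ∀ x y, f x ^ a * g y ^ b ≤ h (a • x + b • y)) :
    ENNReal.ofReal a * (∫⁻ x, f x) + ENNReal.ofReal b * (∫⁻ x, g x) ≤ ∫⁻ x, h x := by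
  have hf_le : ∀ x, f x ≤ 1 := fun x => hf₁ ▸ le_iSup f x
  have hg_le : ∀ x, g x ≤ 1 := fun x => hg₁ ▸ le_iSup g x
  have ne_top : ∀ {u : ℝ≥0∞}, u ≤ 1 → u ≠ ∞ := fun hu => ne_top_of_le_ne_top ENNReal.one_ne_top hu
  refine le_trans ?_ (lintegral_mono fun x => min_le_left (h x) 1)
  rw [lintegral_eq_lintegral_meas_ofReal_lt _ hf fun x => ne_top (hf_le x),
    lintegral_eq_lintegral_meas_ofReal_lt _ hg fun x => ne_top (hg_le x),
    lintegral_eq_lintegral_meas_ofReal_lt _ (hh.min measurable_const) fun x =>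
      ne_top (min_le_right _ _),
    ← lintegral_const_mul _ (antitone_measure_ofReal_lt _ f).measurable,
    ← lintegral_const_mul _ (antitone_measure_ofReal_lt _ g).measurable,
    ← lintegral_add_left ((antitone_measure_ofReal_lt _ f).measurable.const_mul _)]
  refine lintegral_mono fun t => ?_
  rcases le_or_gt 1 (ENNReal.ofReal t) with ht | ht
  · simp [not_lt.2 ((hf_le _).trans ht), not_lt.2 ((hg_le _).trans ht)]
  · have superlevel_nonempty : ∀ {u : ℝ → ℝ≥0∞}, ⨆ x, u x = 1 →
        {x | ENNReal.ofReal t < u x}.Nonempty := fun hu =>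
      nonempty_def.2 (lt_iSup_iff.1 (hu ▸ ht))
    refine ofReal_mul_volume_add_le_volume ha hb (measurableSet_lt measurable_const hf)
      (measurableSet_lt measurable_const hg) (superlevel_nonempty hf₁) (superlevel_nonempty hg₁)
      fun x hx y hy => lt_min ?_ ht
    calc ENNReal.ofReal t = ENNReal.ofReal t ^ a * ENNReal.ofReal t ^ b := by
          rw [← ENNReal.rpow_add_of_nonneg _ _ ha.le hb.le, hab, ENNReal.rpow_one]
      _ < f x ^ a * g y ^ b :=
          ENNReal.mul_lt_mul (ENNReal.rpow_lt_rpow hx ha) (ENNReal.rpow_lt_rpow hy hb)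
      _ ≤ h (a • x + b • y) := H x y

theorem lintegral_rpow_mul_lintegral_rpow_le_of_iSup_ne_top (ha : 0 < a) (hb : 0 < b)
    (hab : a + b = 1) (hf : Measurable f) (hg : Measurable g) (hh : Measurable h)
    (hf_top : ⨆ x, f x ≠ ∞) (hg_top : ⨆ x, g x ≠ ∞)
    (H : ∀ x y, f x ^ a * g y ^ b ≤ h (a • x + b • y)) :
    (∫⁻ x, f x) ^ a * (∫⁻ x, g x) ^ b ≤ ∫⁻ x, h x := by
  set S := ⨆ x, f x with hS
  set T := ⨆ x, g x with hT
  rcases eq_or_ne S 0 with hS₀ | hS₀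
  · have : ∀ x, f x = 0 := by simpa [hS] using hS₀
    simp [this, ha]
  rcases eq_or_ne T 0 with hT₀ | hT₀
  · have : ∀ x, g x = 0 := by simpa [hT] using hT₀
    simp [this, hb]
  have hc : (S⁻¹) ^ a * (T⁻¹) ^ b ≠ 0 := by simp [hf_top, hg_top, ha, hb, ha.le, hb.le]
  have hc_top : (S⁻¹) ^ a * (T⁻¹) ^ b ≠ ∞ := ENNReal.mul_ne_top
    (ENNReal.rpow_ne_top_of_nonneg ha.le (ENNReal.inv_ne_top.2 hS₀))
    (ENNReal.rpow_ne_top_of_nonneg hb.le (ENNReal.inv_ne_top.2 hT₀))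
  have normalized := ofReal_mul_lintegral_add_le_lintegral (f := fun x => S⁻¹ * f x)
    (g := fun x => T⁻¹ * g x) (h := fun x => (S⁻¹) ^ a * (T⁻¹) ^ b * h x) ha hb hab
    (hf.const_mul _) (hg.const_mul _) (hh.const_mul _)
    (by rw [← ENNReal.mul_iSup, ENNReal.inv_mul_cancel hS₀ hf_top])
    (by rw [← ENNReal.mul_iSup, ENNReal.inv_mul_cancel hT₀ hg_top])
    (fun x y => by
      rw [ENNReal.mul_rpow_of_nonneg _ _ ha.le, ENNReal.mul_rpow_of_nonneg _ _ hb.le,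
        mul_mul_mul_comm]
      gcongr
      exact H x y)
  have scaled := (ennreal_geom_mean_le_arith_mean2_weighted ha hb hab _ _).trans normalized
  rw [lintegral_const_mul _ hf, lintegral_const_mul _ hg, lintegral_const_mul _ hh,
    ENNReal.mul_rpow_of_nonneg _ _ ha.le, ENNReal.mul_rpow_of_nonneg _ _ hb.le,
    mul_mul_mul_comm] at scaled
  exact (ENNReal.mul_le_mul_iff_right hc hc_top).1 scaled

end RealLine

/-- The Prékopa–Leindler inequality as a property of a measure `μ`. For measures on `ℝⁿ` it follows
from log-concavity of a density, but it needs no density and no finite dimension, and it passes to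
products and to affine images. -/
def SatisfiesPrekopaLeindler {E : Type*} [AddCommGroup E] [Module ℝ E] [MeasurableSpace E]
    (μ : Measure E) : Prop :=
  ∀ a b : ℝ, 0 < a → 0 < b → a + b = 1 → ∀ f g h : E → ℝ≥0∞,
    Measurable f → Measurable g → Measurable h →
    (∀ x y, f x ^ a * g y ^ b ≤ h (a • x + b • y)) →
    (∫⁻ x, f x ∂μ) ^ a * (∫⁻ x, g x ∂μ) ^ b ≤ ∫⁻ x, h x ∂μ

theorem satisfiesPrekopaLeindler_volume_real :
    SatisfiesPrekopaLeindler (volume : Measure ℝ) := by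
  intro a b ha hb hab f g h hf hg hh H
  have iSup_rpow : ∀ {c : ℝ}, 0 < c → ∀ u : ℕ → ℝ≥0∞, (⨆ N, u N) ^ c = ⨆ N, u N ^ c :=
    fun hc u => (ENNReal.orderIsoRpow _ hc).map_iSup u
  have iSup_min_ne_top : ∀ (u : ℝ → ℝ≥0∞) (N : ℕ), ⨆ x, min (u x) N ≠ ∞ := fun u N =>
    ne_top_of_le_ne_top (ENNReal.natCast_ne_top N) (iSup_le fun x => min_le_right _ _)
  rw [lintegral_eq_iSup_lintegral_min_natCast _ hf, lintegral_eq_iSup_lintegral_min_natCast _ hg,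
    iSup_rpow ha, iSup_rpow hb]
  simp only [ENNReal.iSup_mul, ENNReal.mul_iSup]
  refine iSup_le fun M => iSup_le fun N => ?_
  refine lintegral_rpow_mul_lintegral_rpow_le_of_iSup_ne_top ha hb hab (hf.min measurable_const)
    (hg.min measurable_const) hh (iSup_min_ne_top f _) (iSup_min_ne_top g _)
    fun x y => le_trans ?_ (H x y)
  gcongr <;> exact min_le_left _ _

section PrekopaLeindler

variable {E F : Type*} [AddCommGroup E] [Module ℝ E] [MeasurableSpace E]
  [AddCommGroup F] [Module ℝ F] [MeasurableSpace F]

theorem satisfiesPrekopaLeindler_dirac_zero :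
    SatisfiesPrekopaLeindler (Measure.dirac (0 : E)) := by
  intro a b _ _ _ f g h hf hg hh H
  rw [lintegral_dirac' _ hf, lintegral_dirac' _ hg, lintegral_dirac' _ hh]
  simpa using H 0 0

protected theorem SatisfiesPrekopaLeindler.prod {μ : Measure E} {ν : Measure F} [SFinite ν]
    (hμ : SatisfiesPrekopaLeindler μ) (hν : SatisfiesPrekopaLeindler ν) :
    SatisfiesPrekopaLeindler (μ.prod ν) := by
  intro a b ha hb hab f g h hf hg hh H
  rw [lintegral_prod _ hf.aemeasurable, lintegral_prod _ hg.aemeasurable,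
    lintegral_prod _ hh.aemeasurable]
  refine hμ a b ha hb hab _ _ _ hf.lintegral_prod_right' hg.lintegral_prod_right'
    hh.lintegral_prod_right' fun x y => ?_
  exact hν a b ha hb hab _ _ _ (hf.comp measurable_prodMk_left) (hg.comp measurable_prodMk_left)
    (hh.comp measurable_prodMk_left) fun x' y' => H (x, x') (y, y')

protected theorem SatisfiesPrekopaLeindler.map {μ : Measure E} (hμ : SatisfiesPrekopaLeindler μ)
    (T : E →ᵃ[ℝ] F) (hT : Measurable T) : SatisfiesPrekopaLeindler (μ.map T) := by
  intro a b ha hb hab f g h hf hg hh H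
  rw [lintegral_map hf hT, lintegral_map hg hT, lintegral_map hh hT]
  refine hμ a b ha hb hab _ _ _ (hf.comp hT) (hg.comp hT) (hh.comp hT) fun x y => ?_
  rw [Convex.combo_affine_apply hab]
  exact H _ _

protected theorem SatisfiesPrekopaLeindler.withDensity {μ : Measure E}
    (hμ : SatisfiesPrekopaLeindler μ) {ρ : E → ℝ≥0∞} (hρ_meas : Measurable ρ)
    (hρ : ∀ a b : ℝ, 0 < a → 0 < b → a + b = 1 → ∀ x y, ρ x ^ a * ρ y ^ b ≤ ρ (a • x + b • y)) :
    SatisfiesPrekopaLeindler (μ.withDensity ρ) := by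
  intro a b ha hb hab f g h hf hg hh H
  rw [lintegral_withDensity_eq_lintegral_mul _ hρ_meas hf,
    lintegral_withDensity_eq_lintegral_mul _ hρ_meas hg,
    lintegral_withDensity_eq_lintegral_mul _ hρ_meas hh]
  refine hμ a b ha hb hab _ _ _ (hρ_meas.mul hf) (hρ_meas.mul hg) (hρ_meas.mul hh) fun x y => ?_
  simp only [Pi.mul_apply]
  rw [ENNReal.mul_rpow_of_nonneg _ _ ha.le, ENNReal.mul_rpow_of_nonneg _ _ hb.le,
    mul_mul_mul_comm]
  exact mul_le_mul' (hρ a b ha hb hab x y) (H x y)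

theorem satisfiesPrekopaLeindler_volume_pi :
    ∀ n : ℕ, SatisfiesPrekopaLeindler (volume : Measure (Fin n → ℝ))
  | 0 => by
    rw [Measure.volume_pi_eq_dirac (0 : Fin 0 → ℝ)]
    exact satisfiesPrekopaLeindler_dirac_zero
  | n + 1 => by
    have h_symm := (volume_preserving_piFinSuccAbove (fun _ : Fin (n + 1) => ℝ) 0).symm
    have h_cons : ⇑(MeasurableEquiv.piFinSuccAbove (fun _ : Fin (n + 1) => ℝ) 0).symm =
        (Fin.consLinearEquiv ℝ fun _ : Fin (n + 1) => ℝ).toLinearMap.toAffineMap := by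
      ext x i
      simp [Fin.consLinearEquiv, Fin.insertNthEquiv, MeasurableEquiv.piFinSuccAbove]
    rw [← h_symm.map_eq, h_cons, Measure.volume_eq_prod]
    exact (satisfiesPrekopaLeindler_volume_real.prod (satisfiesPrekopaLeindler_volume_pi n)).map _
      (h_cons ▸ h_symm.measurable)

theorem satisfiesPrekopaLeindler_volume_euclideanSpace (n : ℕ) :
    SatisfiesPrekopaLeindler (volume : Measure (EuclideanSpace ℝ (Fin n))) := by
  rw [← (PiLp.volume_preserving_toLp (Fin n)).map_eq]
  exact (satisfiesPrekopaLeindler_volume_pi n).map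
    (WithLp.linearEquiv 2 ℝ (Fin n → ℝ)).symm.toLinearMap.toAffineMap
    (PiLp.volume_preserving_toLp (Fin n)).measurable

theorem IsLogConcave.satisfiesPrekopaLeindler {n : ℕ} {μ : Measure (EuclideanSpace ℝ (Fin n))}
    (hμ : IsLogConcave μ) : SatisfiesPrekopaLeindler μ := by
  obtain ⟨ρ, hρ_meas, ⟨hρ_nonneg, hρ⟩, rfl⟩ := hμ
  refine (satisfiesPrekopaLeindler_volume_euclideanSpace n).withDensity hρ_meas.ennreal_ofReal
    fun a b ha hb hab x y => ?_
  rw [ENNReal.ofReal_rpow_of_nonneg (hρ_nonneg x) ha.le,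
    ENNReal.ofReal_rpow_of_nonneg (hρ_nonneg y) hb.le,
    ← ENNReal.ofReal_mul (Real.rpow_nonneg (hρ_nonneg x) a)]
  exact ENNReal.ofReal_le_ofReal (hρ x y a b ha hb hab)

protected theorem SatisfiesPrekopaLeindler.tilted {μ : Measure E} (hμ : SatisfiesPrekopaLeindler μ)
    (ℓ : E →ₗ[ℝ] ℝ) (hℓ : Measurable ℓ) : SatisfiesPrekopaLeindler (μ.tilted ℓ) := by
  have hZ : 0 ≤ ∫ y, Real.exp (ℓ y) ∂μ := integral_nonneg fun y => (Real.exp_pos _).le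
  refine hμ.withDensity (by fun_prop) fun a b ha hb hab x y => le_of_eq ?_
  rw [ENNReal.ofReal_rpow_of_nonneg (by positivity) ha.le,
    ENNReal.ofReal_rpow_of_nonneg (by positivity) hb.le, ← ENNReal.ofReal_mul (by positivity),
    Real.div_rpow (Real.exp_pos _).le hZ, Real.div_rpow (Real.exp_pos _).le hZ, div_mul_div_comm,
    ← Real.rpow_add_of_nonneg hZ ha.le hb.le, hab, Real.rpow_one, ← Real.exp_mul, ← Real.exp_mul,
    ← Real.exp_add, map_add, map_smul, map_smul, smul_eq_mul, smul_eq_mul, mul_comm a, mul_comm b]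

protected theorem SatisfiesPrekopaLeindler.tilt {n : ℕ} {μ : Measure (EuclideanSpace ℝ (Fin n))}
    (hμ : SatisfiesPrekopaLeindler μ) (x : EuclideanSpace ℝ (Fin n)) :
    SatisfiesPrekopaLeindler (tilt μ x) := by
  let translation : EuclideanSpace ℝ (Fin n) →ᵃ[ℝ] EuclideanSpace ℝ (Fin n) :=
    AffineMap.id ℝ _ - AffineMap.const ℝ _ (tiltBarycenter μ x)
  exact (hμ.tilted (innerₛₗ ℝ x) (innerSL ℝ x).continuous.measurable).map translation
    (measurable_id.sub_const (tiltBarycenter μ x))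

theorem SatisfiesPrekopaLeindler.measureReal_rpow_mul_le {μ : Measure E} [IsFiniteMeasure μ]
    (hμ : SatisfiesPrekopaLeindler μ) {a b : ℝ} (ha : 0 < a) (hb : 0 < b) (hab : a + b = 1)
    {A B C : Set E} (hA : MeasurableSet A) (hB : MeasurableSet B) (hC : MeasurableSet C)
    (h : ∀ x ∈ A, ∀ y ∈ B, a • x + b • y ∈ C) :
    μ.real A ^ a * μ.real B ^ b ≤ μ.real C := by
  have hPL : μ A ^ a * μ B ^ b ≤ μ C := by
    have := hμ a b ha hb hab (A.indicator 1) (B.indicator 1) (C.indicator 1)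
      (measurable_one.indicator hA) (measurable_one.indicator hB) (measurable_one.indicator hC)
      fun x y => ?_
    · simpa only [lintegral_indicator_one hA, lintegral_indicator_one hB,
        lintegral_indicator_one hC] using this
    by_cases hx : x ∈ A
    · by_cases hy : y ∈ B
      · simp [hx, hy, h x hx y hy]
      · simp [hy, hb]
    · simp [hx, ha]
  simpa only [Measure.real, ENNReal.toReal_mul, ENNReal.toReal_rpow] using
    ENNReal.toReal_mono (measure_ne_top μ C) hPL

end PrekopaLeindler

section Borell

variable {E : Type*} [AddCommGroup E] [Module ℝ E] [MeasurableSpace E] {μ : Measure E}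
  {q : Seminorm ℝ E} {s t : ℝ}

/- Borell's lemma: a point with `q < s` and a point with `t * s ≤ q` are combined with the weights
for which the combination still satisfies `s ≤ q`. -/
theorem SatisfiesPrekopaLeindler.measureReal_lt_rpow_mul_measureReal_le_rpow_le
    [IsFiniteMeasure μ] (hμ : SatisfiesPrekopaLeindler μ) (hq : Measurable q) (ht : 1 < t) :
    μ.real {y | q y < s} ^ ((t - 1) / (t + 1)) * μ.real {y | t * s ≤ q y} ^ (2 / (t + 1)) ≤
      μ.real {y | s ≤ q y} := by
  have ha : 0 < (t - 1) / (t + 1) := div_pos (by linarith) (by linarith)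
  have hb : 0 < 2 / (t + 1) := by positivity
  refine hμ.measureReal_rpow_mul_le ha hb (by field_simp; ring)
    (measurableSet_lt hq measurable_const) (measurableSet_le measurable_const hq)
    (measurableSet_le measurable_const hq) fun x (hx : q x < s) y (hy : t * s ≤ q y) => ?_
  have key : 2 / (t + 1) * q y ≤
      q (((t - 1) / (t + 1)) • x + (2 / (t + 1)) • y) + (t - 1) / (t + 1) * q x := by
    have h := map_sub_le_add q (((t - 1) / (t + 1)) • x + (2 / (t + 1)) • y)
      (((t - 1) / (t + 1)) • x)
    rwa [add_sub_cancel_left, map_smul_eq_mul, map_smul_eq_mul, Real.norm_of_nonneg ha.le,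
      Real.norm_of_nonneg hb.le] at h
  calc s = 2 / (t + 1) * (t * s) - (t - 1) / (t + 1) * s := by field_simp; ring
    _ ≤ 2 / (t + 1) * q y - (t - 1) / (t + 1) * q x := by gcongr
    _ ≤ q (((t - 1) / (t + 1)) • x + (2 / (t + 1)) • y) := sub_le_iff_le_add.2 key

theorem SatisfiesPrekopaLeindler.measureReal_mul_le_le_exp [IsProbabilityMeasure μ]
    (hμ : SatisfiesPrekopaLeindler μ) (hq : Measurable q) {p : ℝ} (hp : 1 ≤ p)
    (hs : μ.real {y | s ≤ q y} ≤ Real.exp (-(3 * p))) (ht : 1 < t) :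
    μ.real {y | t * s ≤ q y} ≤ Real.exp (-(p * (t + 1))) := by
  have half : ∀ {u : ℝ}, 1 ≤ u → Real.exp (-u) ≤ 1 / 2 := fun {u} hu => by
    rw [Real.exp_neg, inv_le_comm₀ (Real.exp_pos u) (by norm_num)]
    linarith [Real.add_one_le_exp u]
  have large : Real.exp (-p) ≤ μ.real {y | q y < s} := by
    have hcompl : {y | q y < s} = {y | s ≤ q y}ᶜ := by ext; simp
    rw [hcompl, probReal_compl_eq_one_sub (measurableSet_le measurable_const hq)]
    linarith [half hp, half (u := 3 * p) (by linarith)]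
  have borell := (hμ.measureReal_lt_rpow_mul_measureReal_le_rpow_le hq ht).trans hs
  set m := μ.real {y | t * s ≤ q y}
  have root : m ^ (2 / (t + 1)) ≤ Real.exp (-(p * (t + 2))) ^ (2 / (t + 1)) := by
    refine le_of_mul_le_mul_left ?_ (Real.exp_pos (-(p * ((t - 1) / (t + 1)))))
    calc Real.exp (-(p * ((t - 1) / (t + 1)))) * m ^ (2 / (t + 1))
        = Real.exp (-p) ^ ((t - 1) / (t + 1)) * m ^ (2 / (t + 1)) := by
          rw [← Real.exp_mul, neg_mul]
      _ ≤ μ.real {y | q y < s} ^ ((t - 1) / (t + 1)) * m ^ (2 / (t + 1)) := by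
          gcongr
      _ ≤ Real.exp (-(3 * p)) := borell
      _ = Real.exp (-(p * ((t - 1) / (t + 1)))) * Real.exp (-(p * (t + 2))) ^ (2 / (t + 1)) := by
          rw [← Real.exp_mul, ← Real.exp_add]
          congr 1
          field_simp
          ring
  calc m ≤ Real.exp (-(p * (t + 2))) :=
        (Real.rpow_le_rpow_iff measureReal_nonneg (Real.exp_pos _).le (by positivity)).1 root
    _ ≤ Real.exp (-(p * (t + 1))) := by
        gcongr
        linarith

end Borell

theorem lintegral_Ioi_ofReal_mul_rpow_neg_two {c T : ℝ} (hc : 0 ≤ c) (hT : 0 < T) :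
    ∫⁻ u in Ioi T, ENNReal.ofReal (c * u ^ (-2 : ℝ)) = ENNReal.ofReal (c / T) := by
  rw [← ofReal_integral_eq_lintegral_ofReal
    ((integrableOn_Ioi_rpow_of_lt (by norm_num) hT).const_mul c),
    integral_const_mul, integral_Ioi_rpow_of_lt (by norm_num) hT]
  · congr 1
    norm_num [Real.rpow_neg_one, div_eq_mul_inv]
  · filter_upwards [ae_restrict_mem measurableSet_Ioi] with u hu
    have : 0 < u := hT.trans hu
    positivity

section ExponentialTail

variable {Ω : Type*} [MeasurableSpace Ω] {μ : Measure Ω} [IsProbabilityMeasure μ] {X : Ω → ℝ}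
  {s p : ℝ}

theorem measure_le_exp_le_of_measureReal_le_exp (hs : 0 < s) (hp : 0 < p)
    (tail : ∀ t, 1 < t → μ.real {ω | t * s ≤ X ω} ≤ Real.exp (-(p * (t + 1))))
    {u : ℝ} (hu : Real.exp (p / 2) < u) :
    μ {ω | u ≤ Real.exp (p / (2 * s) * X ω)} ≤ ENNReal.ofReal (Real.exp (-p) * u ^ (-2 : ℝ)) := by
  have hu_pos : 0 < u := (Real.exp_pos _).trans hu
  have ht : 1 < 2 * Real.log u / p := by
    rw [one_lt_div hp]
    linarith [(Real.lt_log_iff_exp_lt hu_pos).2 hu]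
  have hset : {ω | u ≤ Real.exp (p / (2 * s) * X ω)} = {ω | 2 * Real.log u / p * s ≤ X ω} := by
    ext ω
    simp only [mem_ofPred_eq]
    rw [← Real.log_le_iff_le_exp hu_pos, div_mul_eq_mul_div, div_mul_eq_mul_div,
      le_div_iff₀ (by positivity), div_le_iff₀ hp]
    constructor <;> intro h <;> linarith
  have hexp : Real.exp (-(p * (2 * Real.log u / p + 1))) = Real.exp (-p) * u ^ (-2 : ℝ) := by
    rw [Real.rpow_def_of_pos hu_pos, ← Real.exp_add]
    congr 1
    field_simp
    ring
  rw [hset, ← ofReal_measureReal, ← hexp]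
  exact ENNReal.ofReal_le_ofReal (tail _ ht)

theorem lintegral_ofReal_exp_le_of_measureReal_le_exp (hX : Measurable X) (hs : 0 < s)
    (hp : 1 ≤ p) (tail : ∀ t, 1 < t → μ.real {ω | t * s ≤ X ω} ≤ Real.exp (-(p * (t + 1)))) :
    ∫⁻ ω, ENNReal.ofReal (Real.exp (p / (2 * s) * X ω)) ∂μ ≤ ENNReal.ofReal (Real.exp p) := by
  set T := Real.exp (p / 2) with hT
  have hT_pos : 0 < T := Real.exp_pos _
  have total : T + Real.exp (-p) / T ≤ Real.exp p := by
    have h₁ : 3 / 2 ≤ T := by linarith [Real.add_one_le_exp (p / 2)]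
    have h₂ : Real.exp (-p) / T ≤ 1 / (3 / 2) :=
      div_le_div₀ one_pos.le (Real.exp_le_one_iff.2 (by linarith)) (by norm_num) h₁
    have h₃ : Real.exp p = T * T := by rw [hT, ← Real.exp_add, add_halves]
    nlinarith
  calc ∫⁻ ω, ENNReal.ofReal (Real.exp (p / (2 * s) * X ω)) ∂μ
      = ∫⁻ u in Ioi (0 : ℝ), μ {ω | u ≤ Real.exp (p / (2 * s) * X ω)} :=
        lintegral_eq_lintegral_meas_le μ (ae_of_all _ fun ω => (Real.exp_pos _).le) (by fun_prop)
    _ = (∫⁻ u in Ioc 0 T, μ {ω | u ≤ Real.exp (p / (2 * s) * X ω)}) +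
          ∫⁻ u in Ioi T, μ {ω | u ≤ Real.exp (p / (2 * s) * X ω)} := by
        rw [← Ioc_union_Ioi_eq_Ioi hT_pos.le,
          lintegral_union measurableSet_Ioi Ioc_disjoint_Ioi_same]
    _ ≤ (∫⁻ _ in Ioc 0 T, 1) + ∫⁻ u in Ioi T, ENNReal.ofReal (Real.exp (-p) * u ^ (-2 : ℝ)) :=
        add_le_add (lintegral_mono fun _ => prob_le_one)
          (setLIntegral_mono' measurableSet_Ioi fun _ hu =>
            measure_le_exp_le_of_measureReal_le_exp hs (one_pos.trans_le hp) tail hu)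
    _ = ENNReal.ofReal (T + Real.exp (-p) / T) := by
        rw [lintegral_Ioi_ofReal_mul_rpow_neg_two (Real.exp_pos _).le hT_pos, setLIntegral_one,
          Real.volume_Ioc, sub_zero, ← ENNReal.ofReal_add hT_pos.le (by positivity)]
    _ ≤ ENNReal.ofReal (Real.exp p) := ENNReal.ofReal_le_ofReal total

end ExponentialTail

theorem SatisfiesPrekopaLeindler.lintegral_ofReal_exp_le_of_integral_rpow_le {E : Type*}
    [AddCommGroup E] [Module ℝ E] [MeasurableSpace E] {μ : Measure E} [IsProbabilityMeasure μ]
    (hμ : SatisfiesPrekopaLeindler μ) {q : Seminorm ℝ E} (hq : Measurable q) {p r : ℝ}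
    (hp : 1 ≤ p) (hr : 0 < r) (hint : Integrable (fun y => q y ^ p) μ)
    (hmoment : ∫ y, q y ^ p ∂μ ≤ r ^ p) :
    ∫⁻ y, ENNReal.ofReal (Real.exp (p / (2 * (Real.exp 3 * r)) * q y)) ∂μ ≤
      ENNReal.ofReal (Real.exp p) := by
  have hp₀ : 0 < p := by linarith
  have hs : 0 < Real.exp 3 * r := by positivity
  have markov : μ.real {y | Real.exp 3 * r ≤ q y} ≤ Real.exp (-(3 * p)) := by
    have hset : {y | Real.exp 3 * r ≤ q y} = {y | (Real.exp 3 * r) ^ p ≤ q y ^ p} := by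
      ext y
      exact (Real.rpow_le_rpow_iff hs.le (apply_nonneg q y) hp₀).symm
    have h := (mul_meas_ge_le_integral_of_nonneg
      (ae_of_all _ fun y => Real.rpow_nonneg (apply_nonneg q y) p) hint
      ((Real.exp 3 * r) ^ p)).trans hmoment
    rw [← hset, Real.mul_rpow (Real.exp_pos 3).le hr.le, ← Real.exp_mul, mul_right_comm] at h
    rw [Real.exp_neg, ← one_div, le_div_iff₀' (Real.exp_pos _)]
    exact (mul_le_iff_le_one_left (by positivity)).1 h
  exact lintegral_ofReal_exp_le_of_measureReal_le_exp hq hs hp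
    fun t ht => hμ.measureReal_mul_le_le_exp hq hp markov ht

section Norm

variable {E : Type*} [NormedAddCommGroup E] [NormedSpace ℝ E] [MeasurableSpace E]
  [OpensMeasurableSpace E] {μ : Measure E} [IsProbabilityMeasure μ]

theorem SatisfiesPrekopaLeindler.exists_integrable_exp_mul_norm (hμ : SatisfiesPrekopaLeindler μ)
    (hint : Integrable (fun y => y) μ) :
    ∃ c : ℝ, 0 < c ∧ Integrable (fun y => Real.exp (c * ‖y‖)) μ := by
  set r := (∫ y, ‖y‖ ∂μ) + 1 with hr
  have hr_pos : 0 < r := add_pos_of_nonneg_of_pos (integral_nonneg fun y => norm_nonneg y) one_pos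
  have h := hμ.lintegral_ofReal_exp_le_of_integral_rpow_le (q := normSeminorm ℝ E) (r := r)
    measurable_norm le_rfl hr_pos (by simpa using hint.norm) (by simp [hr])
  refine ⟨1 / (2 * (Real.exp 3 * r)), by positivity, ?_⟩
  rw [← lintegral_ofReal_ne_top_iff_integrable (by fun_prop)
    (ae_of_all _ fun y => (Real.exp_pos _).le)]
  exact ne_top_of_le_ne_top ENNReal.ofReal_ne_top h

theorem SatisfiesPrekopaLeindler.memLp_id (hμ : SatisfiesPrekopaLeindler μ)
    (hint : Integrable (fun y => y) μ) (p : ℝ≥0) : MemLp (fun y => y) p μ := by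
  obtain ⟨c, hc, hexp⟩ := hμ.exists_integrable_exp_mul_norm hint
  have hIic : Iic c ⊆ ProbabilityTheory.integrableExpSet (fun y => ‖y‖) μ := fun t ht =>
    hexp.mono' (by fun_prop) (ae_of_all _ fun y => by
      rw [Real.norm_of_nonneg (Real.exp_pos _).le]
      gcongr
      exact ht)
  rw [← memLp_norm_iff hint.aestronglyMeasurable]
  exact ProbabilityTheory.memLp_of_mem_interior_integrableExpSet
    (mem_interior_iff_mem_nhds.2 (Filter.mem_of_superset (Iic_mem_nhds hc) hIic)) p

end Norm

section LogLaplace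

variable {n : ℕ} {μ : Measure (EuclideanSpace ℝ (Fin n))} {ξ η : EuclideanSpace ℝ (Fin n)}
  {u v L : ℝ}

theorem logLaplace_le_coe_iff : logLaplace μ ξ ≤ u ↔
    ∫⁻ y, ENNReal.ofReal (Real.exp ⟪ξ, y⟫) ∂μ ≤ ENNReal.ofReal (Real.exp u) := by
  rw [← EReal.exp_coe, ← EReal.exp_le_exp_iff, logLaplace, ENNReal.exp_log]

theorem integrable_exp_inner_of_logLaplace_le (h : logLaplace μ ξ ≤ u) :
    Integrable (fun y => Real.exp ⟪ξ, y⟫) μ := by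
  rw [← lintegral_ofReal_ne_top_iff_integrable (by fun_prop)
    (ae_of_all _ fun y => (Real.exp_pos _).le)]
  exact ne_top_of_le_ne_top ENNReal.ofReal_ne_top (logLaplace_le_coe_iff.1 h)

theorem integral_exp_inner_le_of_logLaplace_le (h : logLaplace μ ξ ≤ u) :
    ∫ y, Real.exp ⟪ξ, y⟫ ∂μ ≤ Real.exp u := by
  rw [integral_eq_lintegral_of_nonneg_ae (ae_of_all _ fun y => (Real.exp_pos _).le)
    (by fun_prop)]
  exact ENNReal.toReal_le_of_le_ofReal (Real.exp_pos _).le (logLaplace_le_coe_iff.1 h)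

theorem integral_exp_inner_of_logLaplace_eq (h : logLaplace μ ξ = L) :
    ∫ y, Real.exp ⟪ξ, y⟫ ∂μ = Real.exp L := by
  rw [integral_eq_lintegral_of_nonneg_ae (ae_of_all _ fun y => (Real.exp_pos _).le)
    (by fun_prop), ← ENNReal.exp_log (lintegral _ _), ← logLaplace, h, EReal.exp_coe,
    ENNReal.toReal_ofReal (Real.exp_pos L).le]

theorem logLaplace_zero [IsProbabilityMeasure μ] : logLaplace μ 0 = 0 := by
  simp [logLaplace]

theorem logLaplace_combo_le {a b : ℝ} (ha : 0 ≤ a) (hb : 0 ≤ b) (hab : a + b = 1) :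
    logLaplace μ (a • ξ + b • η) ≤ a * logLaplace μ ξ + b * logLaplace μ η := by
  have holder : ∫⁻ y, ENNReal.ofReal (Real.exp ⟪a • ξ + b • η, y⟫) ∂μ ≤
      (∫⁻ y, ENNReal.ofReal (Real.exp ⟪ξ, y⟫) ∂μ) ^ a *
        (∫⁻ y, ENNReal.ofReal (Real.exp ⟪η, y⟫) ∂μ) ^ b := by
    refine le_of_eq_of_le (lintegral_congr fun y => ?_)
      (ENNReal.lintegral_mul_norm_pow_le (by fun_prop) (by fun_prop) ha hb hab)
    rw [ENNReal.ofReal_rpow_of_pos (Real.exp_pos _), ENNReal.ofReal_rpow_of_pos (Real.exp_pos _),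
      ← ENNReal.ofReal_mul (by positivity), ← Real.exp_mul, ← Real.exp_mul, ← Real.exp_add,
      inner_add_left, real_inner_smul_left, real_inner_smul_left, mul_comm a, mul_comm b]
  simpa only [logLaplace, ENNReal.log_mul_add, ENNReal.log_rpow] using
    ENNReal.log_le_log holder

theorem logLaplace_combo_le_coe {a b : ℝ} (ha : 0 ≤ a) (hb : 0 ≤ b) (hab : a + b = 1)
    (hξ : logLaplace μ ξ ≤ u) (hη : logLaplace μ η ≤ v) :
    logLaplace μ (a • ξ + b • η) ≤ ((a * u + b * v : ℝ) : EReal) := by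
  refine (logLaplace_combo_le ha hb hab).trans ?_
  push_cast
  gcongr

theorem logLaplace_half_smul_le_coe [IsProbabilityMeasure μ] (hξ : logLaplace μ ξ ≤ u) :
    logLaplace μ ((1 / 2 : ℝ) • ξ) ≤ ((u / 2 : ℝ) : EReal) := by
  have h := logLaplace_combo_le_coe (a := 1 / 2) (b := 1 / 2) (v := 0) (by norm_num) (by norm_num)
    (by norm_num) hξ logLaplace_zero.le
  rwa [smul_zero, add_zero, mul_zero, add_zero, one_div_mul_eq_div] at h

theorem IsCentered.logLaplace_nonneg [IsProbabilityMeasure μ] (hμ : IsCentered μ) :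
    0 ≤ logLaplace μ ξ := by
  obtain ⟨hint, hbary⟩ := hμ
  rw [logLaplace, ENNReal.zero_le_log_iff]
  by_cases hfin : Integrable (fun y => Real.exp ⟪ξ, y⟫) μ
  · rw [← ofReal_integral_eq_lintegral_ofReal hfin (ae_of_all _ fun y => (Real.exp_pos _).le),
      ENNReal.one_le_ofReal]
    calc (1 : ℝ) = ∫ y, (⟪ξ, y⟫ + 1) ∂μ := by
          rw [integral_add (hint.const_inner ξ) (integrable_const 1), integral_inner hint ξ, hbary]
          simp
      _ ≤ ∫ y, Real.exp ⟪ξ, y⟫ ∂μ :=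
          integral_mono ((hint.const_inner ξ).add (integrable_const 1)) hfin
            fun y => Real.add_one_le_exp _
  · rw [← lintegral_ofReal_ne_top_iff_integrable (by fun_prop)
      (ae_of_all _ fun y => (Real.exp_pos _).le), not_not] at hfin
    simp [hfin]

theorem IsCentered.exists_logLaplace_eq_coe [IsProbabilityMeasure μ] (hμ : IsCentered μ)
    (hξ : logLaplace μ ξ ≤ u) : ∃ L : ℝ, L ≤ u ∧ logLaplace μ ξ = L := by
  lift logLaplace μ ξ to ℝ using ⟨ne_top_of_le_ne_top (EReal.coe_ne_top u) hξ,
    ne_bot_of_le_ne_bot EReal.zero_ne_bot hμ.logLaplace_nonneg⟩ with L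
  exact ⟨L, EReal.coe_le_coe_iff.1 hξ, rfl⟩

end LogLaplace

section Tilt

variable {n : ℕ} {μ : Measure (EuclideanSpace ℝ (Fin n))} {x z : EuclideanSpace ℝ (Fin n)}
  {u v L : ℝ}

theorem isProbabilityMeasure_tilt [NeZero μ] (hx : Integrable (fun y => Real.exp ⟪x, y⟫) μ) :
    IsProbabilityMeasure (tilt μ x) := by
  have : IsProbabilityMeasure (expTilt μ x) := isProbabilityMeasure_tilted hx
  exact Measure.isProbabilityMeasure_map (by fun_prop)

theorem isCentered_tilt [NeZero μ] (hx : Integrable (fun y => Real.exp ⟪x, y⟫) μ)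
    (hint : Integrable (fun y => y) (expTilt μ x)) : IsCentered (tilt μ x) := by
  have : IsProbabilityMeasure (expTilt μ x) := isProbabilityMeasure_tilted hx
  constructor
  · exact (integrable_map_measure (by fun_prop) (by fun_prop)).2 (hint.sub (integrable_const _))
  · rw [tilt, integral_map (by fun_prop) (by fun_prop), integral_sub hint (integrable_const _)]
    simp [tiltBarycenter]

theorem SatisfiesPrekopaLeindler.integrable_expTilt [IsProbabilityMeasure μ]
    (hμ : SatisfiesPrekopaLeindler μ) (hint : Integrable (fun y => y) μ)
    (hx : Integrable (fun y => Real.exp ⟪x, y⟫) μ)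
    (hx₂ : Integrable (fun y => Real.exp ⟪(2 : ℝ) • x, y⟫) μ) :
    Integrable (fun y => y) (expTilt μ x) := by
  rw [expTilt, integrable_tilted_iff hx, ← memLp_one_iff_integrable]
  have hy : MemLp (fun y => y) 2 μ := mod_cast hμ.memLp_id hint 2
  refine hy.smul ((memLp_two_iff_integrable_sq (by fun_prop)).2 ?_)
  refine hx₂.congr (ae_of_all _ fun y => ?_)
  simp only [real_inner_smul_left, two_mul, Real.exp_add, sq]

theorem logLaplace_tilt (hL : logLaplace μ x = L) :
    logLaplace (tilt μ x) z =
      logLaplace μ (x + z) - ((L + ⟪z, tiltBarycenter μ x⟫ : ℝ) : EReal) := by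
  have hdensity : ∫⁻ y, ENNReal.ofReal (Real.exp ⟪z, y⟫) ∂(tilt μ x) =
      ENNReal.ofReal (Real.exp (-(L + ⟪z, tiltBarycenter μ x⟫))) *
        ∫⁻ y, ENNReal.ofReal (Real.exp ⟪x + z, y⟫) ∂μ := by
    rw [tilt, lintegral_map (by fun_prop) (by fun_prop), expTilt, lintegral_tilted,
      integral_exp_inner_of_logLaplace_eq hL, ← lintegral_const_mul _ (by fun_prop)]
    refine lintegral_congr fun y => ?_
    rw [← Real.exp_sub, ← ENNReal.ofReal_mul (Real.exp_pos _).le,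
      ← ENNReal.ofReal_mul (Real.exp_pos _).le, ← Real.exp_add, ← Real.exp_add, inner_add_left,
      inner_sub_right]
    congr 2
    ring
  rw [logLaplace, hdensity, ENNReal.log_mul_add, ENNReal.log_ofReal_of_pos (Real.exp_pos _),
    Real.log_exp, EReal.coe_neg, ← logLaplace, add_comm, sub_eq_add_neg]

theorem logLaplace_tilt_le_coe_iff (hL : logLaplace μ x = L) :
    logLaplace (tilt μ x) z ≤ u ↔
      logLaplace μ (x + z) ≤ ((u + L + ⟪z, tiltBarycenter μ x⟫ : ℝ) : EReal) := by
  rw [logLaplace_tilt hL, EReal.sub_le_iff_le_add (.inl (EReal.coe_ne_bot _))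
    (.inl (EReal.coe_ne_top _)), ← EReal.coe_add, add_assoc]

/- The unknown term `⟪z, tiltBarycenter μ x⟫` of `logLaplace_tilt_le_coe_iff` changes sign with `z`,
so it is controlled by the nonnegativity of the transform at the opposite point. -/
theorem logLaplace_tilt_le_of_add_of_sub [IsProbabilityMeasure (tilt μ x)]
    (hν : IsCentered (tilt μ x)) (hL : logLaplace μ x = L)
    (hadd : logLaplace μ (x + z) ≤ u) (hsub : logLaplace μ (x - z) ≤ v) :
    logLaplace (tilt μ x) z ≤ ((u + v - 2 * L : ℝ) : EReal) := by
  have hneg : logLaplace (tilt μ x) (-z) ≤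
      ((v - L + ⟪z, tiltBarycenter μ x⟫ : ℝ) : EReal) := by
    rw [logLaplace_tilt_le_coe_iff hL, inner_neg_left, ← sub_eq_add_neg]
    refine hsub.trans_eq ?_
    congr 1
    ring
  have hbalance : 0 ≤ v - L + ⟪z, tiltBarycenter μ x⟫ :=
    EReal.coe_nonneg.1 (hν.logLaplace_nonneg.trans hneg)
  rw [logLaplace_tilt_le_coe_iff hL]
  refine hadd.trans (EReal.coe_le_coe_iff.2 ?_)
  linarith

theorem logLaplace_add_le_of_tilt [IsProbabilityMeasure μ] (hμ : IsCentered μ)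
    (hL : logLaplace μ x = L) (hpos : logLaplace (tilt μ x) z ≤ u)
    (hneg : logLaplace (tilt μ x) (-z) ≤ v) :
    logLaplace μ (x + z) ≤ ((u + v + 2 * L : ℝ) : EReal) := by
  rw [logLaplace_tilt_le_coe_iff hL] at hpos hneg
  have hbalance : 0 ≤ v + L + ⟪-z, tiltBarycenter μ x⟫ :=
    EReal.coe_nonneg.1 (hμ.logLaplace_nonneg.trans hneg)
  refine hpos.trans (EReal.coe_le_coe_iff.2 ?_)
  rw [inner_neg_left] at hbalance
  linarith

end Tilt

section LambdaBody

variable {n : ℕ} {μ : Measure (EuclideanSpace ℝ (Fin n))} [IsProbabilityMeasure μ]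
  {x z ξ : EuclideanSpace ℝ (Fin n)} {p : ℝ}

theorem half_smul_mem_lambdaBody (hpos : logLaplace μ ξ ≤ ((2 * p : ℝ) : EReal))
    (hneg : logLaplace μ (-ξ) ≤ ((2 * p : ℝ) : EReal)) : (1 / 2 : ℝ) • ξ ∈ lambdaBody p μ := by
  refine ⟨(logLaplace_half_smul_le_coe hpos).trans_eq ?_, ?_⟩
  · rw [mul_div_cancel_left₀ p two_ne_zero]
  · rw [mem_neg, ← smul_neg]
    refine (logLaplace_half_smul_le_coe hneg).trans_eq ?_
    rw [mul_div_cancel_left₀ p two_ne_zero]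

theorem IsCentered.nonneg_of_mem_lambdaBody (hμ : IsCentered μ) (hξ : ξ ∈ lambdaBody p μ) :
    0 ≤ p :=
  EReal.coe_nonneg.1 (hμ.logLaplace_nonneg.trans hξ.1)

theorem integrable_exp_inner_of_mem_half_smul_lambdaBody (hx : x ∈ (1 / 2 : ℝ) • lambdaBody p μ) :
    Integrable (fun y => Real.exp ⟪x, y⟫) μ := by
  obtain ⟨w, hw, rfl⟩ := hx
  exact integrable_exp_inner_of_logLaplace_le (logLaplace_half_smul_le_coe hw.1)

theorem SatisfiesPrekopaLeindler.integrable_expTilt_of_mem_half_smul_lambdaBody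
    (hμ : SatisfiesPrekopaLeindler μ) (hint : Integrable (fun y => y) μ)
    (hx : x ∈ (1 / 2 : ℝ) • lambdaBody p μ) : Integrable (fun y => y) (expTilt μ x) := by
  refine hμ.integrable_expTilt hint (integrable_exp_inner_of_mem_half_smul_lambdaBody hx) ?_
  obtain ⟨w, hw, rfl⟩ := hx
  simpa [smul_smul] using integrable_exp_inner_of_logLaplace_le hw.1

theorem quarter_smul_mem_lambdaBody_tilt (hμ : IsCentered μ)
    [IsProbabilityMeasure (tilt μ x)] (hν : IsCentered (tilt μ x))
    (hx : x ∈ (1 / 2 : ℝ) • lambdaBody p μ) (hz : z ∈ lambdaBody p μ) :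
    (1 / 4 : ℝ) • z ∈ lambdaBody p (tilt μ x) := by
  obtain ⟨w, hw, rfl⟩ := hx
  set x := (1 / 2 : ℝ) • w
  obtain ⟨L, -, hL⟩ := hμ.exists_logLaplace_eq_coe (logLaplace_half_smul_le_coe hw.1)
  have hL_nonneg : 0 ≤ L := EReal.coe_nonneg.1 (hL ▸ hμ.logLaplace_nonneg)
  have midpoint : ∀ ζ, logLaplace μ ζ ≤ p → logLaplace μ (x + (1 / 2 : ℝ) • ζ) ≤ p :=
    fun ζ hζ => by
      refine (logLaplace_combo_le_coe (by norm_num) (by norm_num) (by norm_num)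
        hw.1 hζ).trans_eq ?_
      congr 1
      ring
  have hadd := midpoint z hz.1
  have hsub : logLaplace μ (x - (1 / 2 : ℝ) • z) ≤ p := by
    simpa only [smul_neg, ← sub_eq_add_neg] using midpoint (-z) hz.2
  have h2p : ((p + p - 2 * L : ℝ) : EReal) ≤ ((2 * p : ℝ) : EReal) :=
    EReal.coe_le_coe_iff.2 (by linarith)
  have hpos := (logLaplace_tilt_le_of_add_of_sub hν hL hadd hsub).trans h2p
  have hneg : logLaplace (tilt μ x) (-((1 / 2 : ℝ) • z)) ≤ ((2 * p : ℝ) : EReal) := by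
    refine (logLaplace_tilt_le_of_add_of_sub hν hL ?_ ?_).trans h2p
    · rwa [← sub_eq_add_neg]
    · rwa [sub_neg_eq_add]
  convert half_smul_mem_lambdaBody hpos hneg using 1
  rw [smul_smul]
  norm_num

theorem quarter_smul_mem_lambdaBody_of_tilt (hμ : IsCentered μ)
    (hx : x ∈ (1 / 2 : ℝ) • lambdaBody p μ) (hz : z ∈ lambdaBody p (tilt μ x)) :
    (1 / 4 : ℝ) • z ∈ lambdaBody p μ := by
  obtain ⟨w, hw, rfl⟩ := hx
  have hp : 0 ≤ p := hμ.nonneg_of_mem_lambdaBody hw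
  set x := (1 / 2 : ℝ) • w with hx_def
  obtain ⟨L, hL_le, hL⟩ := hμ.exists_logLaplace_eq_coe (logLaplace_half_smul_le_coe hw.1)
  have hneg_x : logLaplace μ (-x) ≤ ((p / 2 : ℝ) : EReal) := by
    rw [hx_def, ← smul_neg]
    exact logLaplace_half_smul_le_coe hw.2
  -- `ζ / 2` is the midpoint of `x + ζ` and `-x`.
  have half : ∀ ζ, logLaplace (tilt μ x) ζ ≤ p → logLaplace (tilt μ x) (-ζ) ≤ p →
      logLaplace μ ((1 / 2 : ℝ) • ζ) ≤ ((2 * p : ℝ) : EReal) := fun ζ hpos hneg => by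
    have h := logLaplace_combo_le_coe (a := 1 / 2) (b := 1 / 2) (by norm_num) (by norm_num)
      (by norm_num) (logLaplace_add_le_of_tilt hμ hL hpos hneg) hneg_x
    rw [smul_add, smul_neg, add_neg_cancel_comm] at h
    exact h.trans (EReal.coe_le_coe_iff.2 (by linarith))
  have hpos := half z hz.1 hz.2
  have hneg := half (-z) hz.2 (by rw [neg_neg]; exact hz.1)
  rw [smul_neg] at hneg
  convert half_smul_mem_lambdaBody hpos hneg using 1
  rw [smul_smul]
  norm_num

theorem isoWith_inv_of_smul_subset {c : ℝ} (hc : c ≠ 0)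
    {K T : Set (EuclideanSpace ℝ (Fin n))} (hKT : c • K ⊆ T) (hTK : c • T ⊆ K) :
    IsoWith c c⁻¹ K T :=
  ⟨hKT, (subset_smul_set_iff₀ (inv_ne_zero hc)).2 (by rwa [inv_inv])⟩

end LambdaBody

section CentroidBody

variable {n : ℕ} {μ ν : Measure (EuclideanSpace ℝ (Fin n))} {θ : EuclideanSpace ℝ (Fin n)}
  {p c r : ℝ}

theorem centroidSupport_nonneg : 0 ≤ centroidSupport p μ θ :=
  Real.rpow_nonneg (integral_nonneg fun _ => Real.rpow_nonneg (abs_nonneg _) _) _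

theorem centroidSupport_smul (hp : p ≠ 0) (hc : 0 ≤ c) :
    centroidSupport p μ (c • θ) = c * centroidSupport p μ θ := by
  simp only [centroidSupport, real_inner_smul_right, abs_mul, abs_of_nonneg hc,
    Real.mul_rpow hc (abs_nonneg _), integral_const_mul]
  rw [Real.mul_rpow (by positivity) (integral_nonneg fun _ => by positivity), one_div,
    Real.rpow_rpow_inv hc hp]

theorem centroidSupport_le_of_mem_lambdaBody (hp : 1 ≤ p) (hθ : θ ∈ lambdaBody p μ) :
    centroidSupport p μ θ ≤ 2 * Real.exp 1 * p := by
  have hp₀ : 0 < p := by linarith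
  have hpos := integrable_exp_inner_of_logLaplace_le hθ.1
  have hneg := integrable_exp_inner_of_logLaplace_le hθ.2
  have pointwise : ∀ y, |⟪y, θ⟫| ^ p ≤ p ^ p * (Real.exp ⟪θ, y⟫ + Real.exp ⟪-θ, y⟫) := fun y => by
    refine (ProbabilityTheory.rpow_abs_le_mul_max_exp ⟪y, θ⟫ hp₀.le one_ne_zero).trans ?_
    rw [abs_one, div_one, one_mul, neg_one_mul, real_inner_comm, inner_neg_left]
    gcongr
    exact max_le_add_of_nonneg (Real.exp_pos _).le (Real.exp_pos _).le
  have moment : ∫ y, |⟪y, θ⟫| ^ p ∂μ ≤ (2 * Real.exp 1 * p) ^ p := by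
    calc ∫ y, |⟪y, θ⟫| ^ p ∂μ
        ≤ ∫ y, p ^ p * (Real.exp ⟪θ, y⟫ + Real.exp ⟪-θ, y⟫) ∂μ :=
          integral_mono_of_nonneg (ae_of_all _ fun _ => by positivity)
            ((hpos.add hneg).const_mul _) (ae_of_all _ pointwise)
      _ = p ^ p * (∫ y, Real.exp ⟪θ, y⟫ ∂μ + ∫ y, Real.exp ⟪-θ, y⟫ ∂μ) := by
          rw [integral_const_mul, integral_add hpos hneg]
      _ ≤ p ^ p * (Real.exp p + Real.exp p) := by
          gcongr
          · exact integral_exp_inner_le_of_logLaplace_le hθ.1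
          · exact integral_exp_inner_le_of_logLaplace_le hθ.2
      _ = 2 * (Real.exp 1 * p) ^ p := by
          rw [Real.mul_rpow (Real.exp_pos 1).le hp₀.le, Real.exp_one_rpow]
          ring
      _ ≤ 2 ^ p * (Real.exp 1 * p) ^ p := by
          gcongr
          exact Real.self_le_rpow_of_one_le one_le_two hp
      _ = (2 * Real.exp 1 * p) ^ p := by
          rw [← Real.mul_rpow zero_le_two (by positivity), mul_assoc]
  rw [centroidSupport, one_div, Real.rpow_inv_le_iff_of_pos
    (integral_nonneg fun _ => by positivity) (by positivity) hp₀]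
  exact moment

theorem SatisfiesPrekopaLeindler.smul_mem_lambdaBody [IsProbabilityMeasure μ]
    (hμ : SatisfiesPrekopaLeindler μ) (hint : Integrable (fun y => y) μ) (hp : 1 ≤ p)
    (hr : 0 < r) (hθ : centroidSupport p μ θ ≤ r) :
    (p / (2 * (Real.exp 3 * r))) • θ ∈ lambdaBody p μ := by
  set q : Seminorm ℝ (EuclideanSpace ℝ (Fin n)) := (innerₛₗ ℝ θ).toSeminorm
  have hq : ∀ y, q y = |⟪θ, y⟫| := fun y => rfl
  have hp₀ : 0 < p := by linarith
  have hmemLp : MemLp (fun y => ⟪θ, y⟫) p.toNNReal μ := (hμ.memLp_id hint _).const_inner θ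
  have hmoment_int : Integrable (fun y => q y ^ p) μ := by
    simpa only [hq, ENNReal.coe_toReal, Real.coe_toNNReal p hp₀.le, Real.norm_eq_abs] using
      hmemLp.integrable_norm_rpow (by simpa using hp₀) ENNReal.coe_ne_top
  have hmoment : ∫ y, q y ^ p ∂μ ≤ r ^ p := by
    rw [centroidSupport, one_div, Real.rpow_inv_le_iff_of_pos
      (integral_nonneg fun _ => by positivity) hr.le hp₀] at hθ
    simpa only [hq, real_inner_comm] using hθ
  have hexp := hμ.lintegral_ofReal_exp_le_of_integral_rpow_le (q := q)
    (show Measurable fun y => |⟪θ, y⟫| by fun_prop) hp hr hmoment_int hmoment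
  have bound : ∀ η : EuclideanSpace ℝ (Fin n), (∀ y, ⟪η, y⟫ ≤ q y) →
      logLaplace μ ((p / (2 * (Real.exp 3 * r))) • η) ≤ p := fun η hη => by
    refine logLaplace_le_coe_iff.2 (le_trans (lintegral_mono fun y => ?_) hexp)
    rw [real_inner_smul_left]
    gcongr
    exact hη y
  refine ⟨bound θ fun y => le_abs_self _, ?_⟩
  rw [mem_neg, ← smul_neg]
  exact bound (-θ) fun y => by rw [inner_neg_left]; exact neg_le_abs _

theorem centroidSupport_le_of_smul_lambdaBody_subset [IsProbabilityMeasure ν]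
    (hν : SatisfiesPrekopaLeindler ν) (hint : Integrable (fun y => y) ν) (hp : 1 ≤ p)
    (hc : 0 < c) (hsub : c • lambdaBody p ν ⊆ lambdaBody p μ) (θ : EuclideanSpace ℝ (Fin n)) :
    c / (4 * Real.exp 4) * centroidSupport p μ θ ≤ centroidSupport p ν θ := by
  have hp₀ : 0 < p := by linarith
  refine le_of_forall_gt_imp_ge_of_dense fun r hr => ?_
  have hr₀ : 0 < r := centroidSupport_nonneg.trans_lt hr
  have hmem := hsub (smul_mem_smul_set (hν.smul_mem_lambdaBody hint hp hr₀ hr.le))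
  have h := centroidSupport_le_of_mem_lambdaBody hp hmem
  rw [centroidSupport_smul hp₀.ne' hc.le, centroidSupport_smul hp₀.ne' (by positivity)] at h
  calc c / (4 * Real.exp 4) * centroidSupport p μ θ
      = c * (p / (2 * (Real.exp 3 * r)) * centroidSupport p μ θ) *
          (r / (2 * Real.exp 1 * p)) := by
        rw [show (4 : ℝ) = 3 + 1 by norm_num, Real.exp_add]
        field_simp
        ring
    _ ≤ 2 * Real.exp 1 * p * (r / (2 * Real.exp 1 * p)) := by gcongr
    _ = r := by field_simp

theorem smul_centroidBody_subset (hc : 0 ≤ c)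
    (h : ∀ θ, c * centroidSupport p μ θ ≤ centroidSupport p ν θ) :
    c • centroidBody p μ ⊆ centroidBody p ν := by
  rintro _ ⟨y, hy, rfl⟩ θ
  rw [real_inner_smul_left]
  exact (mul_le_mul_of_nonneg_left (hy θ) hc).trans (h θ)

end CentroidBody

section TiltStability

variable {n : ℕ} {μ : Measure (EuclideanSpace ℝ (Fin n))} [IsProbabilityMeasure μ]
  {x : EuclideanSpace ℝ (Fin n)} {p : ℝ}

theorem IsCentered.isoWith_lambdaBody_tilt (hμ : IsCentered μ)
    (hx : x ∈ (1 / 2 : ℝ) • lambdaBody p μ) (hint : Integrable (fun y => y) (expTilt μ x)) :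
    IsoWith (1 / 4) (1 / 4)⁻¹ (lambdaBody p (tilt μ x)) (lambdaBody p μ) := by
  have hexp := integrable_exp_inner_of_mem_half_smul_lambdaBody hx
  have := isProbabilityMeasure_tilt hexp
  refine isoWith_inv_of_smul_subset (by norm_num) ?_ ?_
  · exact smul_set_subset_iff.2 fun z hz => quarter_smul_mem_lambdaBody_of_tilt hμ hx hz
  · exact smul_set_subset_iff.2 fun z hz =>
      quarter_smul_mem_lambdaBody_tilt hμ (isCentered_tilt hexp hint) hx hz

theorem SatisfiesPrekopaLeindler.isoWith_centroidBody_tilt (hPL : SatisfiesPrekopaLeindler μ)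
    (hμ : IsCentered μ) (hp : 1 ≤ p) (hx : x ∈ (1 / 2 : ℝ) • lambdaBody p μ) :
    IsoWith (1 / 4 / (4 * Real.exp 4)) (1 / 4 / (4 * Real.exp 4))⁻¹
      (centroidBody p (tilt μ x)) (centroidBody p μ) := by
  have hexp := integrable_exp_inner_of_mem_half_smul_lambdaBody hx
  have := isProbabilityMeasure_tilt hexp
  have hint := hPL.integrable_expTilt_of_mem_half_smul_lambdaBody hμ.1 hx
  have hν := isCentered_tilt hexp hint
  refine isoWith_inv_of_smul_subset (by positivity)
    (smul_centroidBody_subset (by positivity) ?_) (smul_centroidBody_subset (by positivity) ?_)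
  · exact centroidSupport_le_of_smul_lambdaBody_subset hPL hμ.1 hp (by norm_num)
      (smul_set_subset_iff.2 fun z hz => quarter_smul_mem_lambdaBody_tilt hμ hν hx hz)
  · exact centroidSupport_le_of_smul_lambdaBody_subset (hPL.tilt x) hν.1 hp (by norm_num)
      (smul_set_subset_iff.2 fun z hz => quarter_smul_mem_lambdaBody_of_tilt hμ hx hz)

end TiltStability

end LogConcaveTilt

open LogConcaveTilt MeasureTheory in
theorem mainTheorem9_general :
    (∃ c C : ℝ, 0 < c ∧ 0 < C ∧
      ∀ (n : ℕ) (μ : Measure (EuclideanSpace ℝ (Fin n))) [IsProbabilityMeasure μ],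
        IsCentered μ → ∀ p : ℝ, ∀ x ∈ (1 / 2 : ℝ) • lambdaBody p μ,
          Integrable (fun y => y) (expTilt μ x) →
            IsoWith c C (lambdaBody p (tilt μ x)) (lambdaBody p μ)) ∧
    (∃ c C : ℝ, 0 < c ∧ 0 < C ∧
      ∀ (n : ℕ) (μ : Measure (EuclideanSpace ℝ (Fin n))) [IsProbabilityMeasure μ],
        SatisfiesPrekopaLeindler μ → IsCentered μ →
        ∀ p : ℝ, 1 ≤ p → ∀ x ∈ (1 / 2 : ℝ) • lambdaBody p μ,
          IsoWith c C (centroidBody p (tilt μ x)) (centroidBody p μ)) := by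
  constructor
  · exact ⟨_, _, by norm_num, by norm_num, fun _ _ _ hμ _ _ hx hint =>
      hμ.isoWith_lambdaBody_tilt hx hint⟩
  · exact ⟨_, _, by positivity, by positivity, fun _ _ _ hPL hμ _ hp _ hx =>
      hPL.isoWith_centroidBody_tilt hμ hp hx⟩

theorem mainTheorem9 :
    (∃ c C : ℝ, 0 < c ∧ 0 < C ∧
      ∀ (n : ℕ) (μ : MeasureTheory.Measure (EuclideanSpace ℝ (Fin n)))
        [MeasureTheory.IsProbabilityMeasure μ],
        LogConcaveTilt.IsLogConcave μ → LogConcaveTilt.IsCentered μ →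
        ∀ p : ℝ, 0 ≤ p →
        ∀ x ∈ (1 / 2 : ℝ) • LogConcaveTilt.lambdaBody p μ,
          LogConcaveTilt.IsoWith c C
            (LogConcaveTilt.lambdaBody p (LogConcaveTilt.tilt μ x))
            (LogConcaveTilt.lambdaBody p μ)) ∧
    (∃ c C : ℝ, 0 < c ∧ 0 < C ∧
      ∀ (n : ℕ) (μ : MeasureTheory.Measure (EuclideanSpace ℝ (Fin n)))
        [MeasureTheory.IsProbabilityMeasure μ],
        LogConcaveTilt.IsLogConcave μ → LogConcaveTilt.IsCentered μ →
        ∀ p : ℝ, 1 ≤ p →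
        ∀ x ∈ (1 / 2 : ℝ) • LogConcaveTilt.lambdaBody p μ,
          LogConcaveTilt.IsoWith c C
            (LogConcaveTilt.centroidBody p (LogConcaveTilt.tilt μ x))
            (LogConcaveTilt.centroidBody p μ)) := by
  obtain ⟨⟨c, C, hc, hC, hΛ⟩, ⟨c', C', hc', hC', hZ⟩⟩ := mainTheorem9_general
  exact ⟨⟨c, C, hc, hC, fun n μ _ hμ hcent p _ x hx => hΛ n μ hcent p x hx
      (hμ.satisfiesPrekopaLeindler.integrable_expTilt_of_mem_half_smul_lambdaBody hcent.1 hx)⟩,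
    ⟨c', C', hc', hC', fun n μ _ hμ => hZ n μ hμ.satisfiesPrekopaLeindler⟩⟩
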